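/- A frequency is a strictly increasing sequence $\lambda=(\lambda_n)_{n\ge 1}$ of non-negative real numbers with $\lambda_n\to\infty$. For a $\lambda$-Dirichlet series $D=\sum a_n e^{-\lambda_n s}$ with complex coefficients, $k\ge 0$, $x>0$ and $s\in\mathbb{C}$ put $$R_x^{\lambda,k}(D)(s)=\sum_{\lambda_n<x}a_n e^{-\lambda_n s}\Big(1-\frac{\lambda_n}{x}\Big)^k ,$$ and let $\sigma_c^{\lambda,k}(D)\in[-\infty,\infty]$ be the infimum of all $\sigma\in\mathbb{R}$ for which $\lim_{x\to\infty}R_x^{\lambda,k}(D)(\sigma)$ exists in $\mathbb{C}$. A holomorphic function $f\colon[\operatorname{Re}>0]\to\mathbb{C}$ has the $\lambda$-Riesz germ $D$ if, for some $m\ge 0$, $\sigma_c^{\lambda,m}(D)<\infty$ and $f(s)=\lim_{x\to\infty}R_x^{\lambda,m}(D)(s)$ for all $s$ with $\operatorname{Re}s>0$ and $\operatorname{Re}s>\sigma_c^{\lambda,m}(D)$. For $\ell\ge 0$, $H_{\infty,\ell}^{\lambda}[\operatorname{Re}>0]$ is the space of all holomorphic functions $f\colon[\operatorname{Re}>0]\to\mathbb{C}$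 which have a $\lambda$-Riesz germ and satisfy $$\sup_{\operatorname{Re}s>0}\frac{|f(s)|}{(1+|s|)^{\ell}}<\infty .$$ The uniform order $\nu_f\in[0,\infty]$ of $f$ on $[\operatorname{Re}>0]$ is the infimum of all real $\ell\ge 0$ for which there are $C,t_0>0$ with $$|f(\sigma+it)|\le C|t|^{\ell}\quad\text{for all }\sigma>0\text{ and all }t\in\mathbb{R}\text{ with }|t|>t_0$$ ($\nu_f=\infty$ if there is no such $\ell$), and $f$ has finite uniform order if $\nu_f<\infty$. Theorem. Let $\lambda$ be a frequency and let $f\colon[\operatorname{Re}>0]\to\mathbb{C}$ be a holomorphic function which has a $\lambda$-Riesz germ. (1) If $\ell\ge 0$ and $f\in H_{\infty,\ell}^{\lambda}[\operatorname{Re}>0]$, then $f$ has finite uniform order on $[\operatorname{Re}>0]$ and $\nu_f\le\ell$. (2) Conversely, if $f$ has finite uniform order $\nu_f$ on $[\operatorname{Re}>0]$, then $f_\mu=f(\mu+\,\cdot\,)\in H_{\infty,\ell}^{\lambda}[\operatorname{Re}>0]$ for all $\mu>0$ and all real $\ell>\nu_f$. -/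

import Mathlib

open Filter Topology
open scoped NNReal ENNReal

noncomputable section

/-- A frequency: a strictly increasing sequence of non-negative real numbers tending to infinity
(the first term is `lam 0`). -/
structure Frequency where
  toFun : ℕ → ℝ
  strictMono : StrictMono toFun
  nonneg : ∀ n, 0 ≤ toFun n
  tendsto_atTop : Tendsto toFun atTop atTop

instance : CoeFun Frequency (fun _ => ℕ → ℝ) := ⟨Frequency.toFun⟩

theorem Frequency.finite_below (lam : Frequency) (x : ℝ) : {n : ℕ | lam n < x}.Finite := by
  obtain ⟨N, hN⟩ := (lam.tendsto_atTop.eventually_ge_atTop x).exists_forall_of_atTop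
  refine (Set.finite_lt_nat N).subset fun n hn => ?_
  by_contra h
  exact absurd (hN n (not_lt.mp h)) (not_le.mpr hn)

/-- The finite set of indices `n` with `lam n < x`. -/
def Frequency.below (lam : Frequency) (x : ℝ) : Finset ℕ := (lam.finite_below x).toFinset

/-- The open right half-plane. -/
def rightHalfPlane : Set ℂ := {s | 0 < s.re}

/-- The Riesz mean of order `k` of the Dirichlet series `∑ aₙ e^{-λₙ s}`,
`∑_{λₙ < x} aₙ e^{-λₙ s} (1 - λₙ / x)^k`. -/
def rieszMean (lam : Frequency) (k : ℝ) (a : ℕ → ℂ) (x : ℝ) (s : ℂ) : ℂ :=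
  ∑ n ∈ lam.below x,
    a n * Complex.exp (-(lam n : ℂ) * s) * (((1 - lam n / x) ^ k : ℝ) : ℂ)

/-- The Dirichlet series with coefficients `a` is Riesz summable of order `k` at `s`. -/
def RieszSummableAt (lam : Frequency) (k : ℝ) (a : ℕ → ℂ) (s : ℂ) : Prop :=
  ∃ L : ℂ, Tendsto (fun x : ℝ => rieszMean lam k a x s) atTop (𝓝 L)

/-- The abscissa of Riesz summability of order `k`, an extended real number. -/
def rieszAbscissa (lam : Frequency) (k : ℝ) (a : ℕ → ℂ) : EReal :=
  sInf ((fun σ : ℝ => (σ : EReal)) '' {σ : ℝ | RieszSummableAt lam k a (σ : ℂ)})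

/-- The Dirichlet series with coefficients `a` is a Riesz germ of the function `f` on the right
half-plane: for some order `m ≥ 0` its abscissa of Riesz summability is not `+∞`, and `f` agrees
with its limit function wherever both are defined. -/
def IsRieszGerm (lam : Frequency) (a : ℕ → ℂ) (f : ℂ → ℂ) : Prop :=
  ∃ m : ℝ, 0 ≤ m ∧ rieszAbscissa lam m a < ⊤ ∧
    ∀ s ∈ rightHalfPlane, rieszAbscissa lam m a < (s.re : EReal) →
      Tendsto (fun x : ℝ => rieszMean lam m a x s) atTop (𝓝 (f s))

/-- `f` has a Riesz germ with respect to the frequency `lam`. -/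
def HasRieszGerm (lam : Frequency) (f : ℂ → ℂ) : Prop :=
  ∃ a : ℕ → ℂ, IsRieszGerm lam a f

/-- The space `H_{∞,ℓ}^λ` of holomorphic functions on the right half-plane that have a Riesz germ
and satisfy `sup_{Re s > 0} |f s| / (1 + |s|)^ℓ < ∞`. Only the values of `f` on the right
half-plane matter. -/
def HInfty (lam : Frequency) (l : ℝ) : Set (ℂ → ℂ) :=
  {f | DifferentiableOn ℂ f rightHalfPlane ∧ HasRieszGerm lam f ∧
    BddAbove ((fun s : ℂ => ‖f s‖ / (1 + ‖s‖) ^ l) '' rightHalfPlane)}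

/-- There are `C, t₀ > 0` with `|f (σ + it)| ≤ C |t|^ℓ` for all `σ > σ₀` and all `|t| > t₀`. -/
def UniformOrderBound (f : ℂ → ℂ) (σ₀ : ℝ) (l : ℝ) : Prop :=
  ∃ C > (0 : ℝ), ∃ t₀ > (0 : ℝ), ∀ σ > σ₀, ∀ t : ℝ, t₀ < |t| →
    ‖f ((σ : ℂ) + (t : ℂ) * Complex.I)‖ ≤ C * |t| ^ l

/-- The uniform order of `f` on the half-plane `Re s > σ₀`, an element of `[0, ∞]`; it is `∞` if
no finite exponent is admissible. -/
def uniformOrder (f : ℂ → ℂ) (σ₀ : ℝ) : ℝ≥0∞ :=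
  sInf ((fun l : ℝ≥0 => (l : ℝ≥0∞)) '' {l : ℝ≥0 | UniformOrderBound f σ₀ (l : ℝ)})

/-- `f` has finite uniform order on the half-plane `Re s > σ₀`. -/
def HasFiniteUniformOrder (f : ℂ → ℂ) (σ₀ : ℝ) : Prop := uniformOrder f σ₀ < ⊤

end

/-! The weights `|t|^ℓ` and `(1 + |s|)^ℓ` are comparable where `|t|` is large and `σ ≤ |t|`. They
differ where `σ ≥ |t|`, and for small `|t|` the uniform order gives no information. The Riesz germ
fills this gap: `f` is bounded on the sector `|Im s| ≤ Re s` far to the right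
(`HasRieszGerm.exists_norm_le`). For the converse there remain bounded `σ` and `t`, which the shift
by `μ > 0` confines to a compact rectangle inside the half-plane.

For the sector bound, the order is raised to an integer `N` (`tendsto_rieszMean_add_one`), so that
the means at some real `σ₀` are bounded by some `C`. Integration by parts writes the mean of order
`N + 1` at `σ₀ + w` as an integral of these against a derivative of `e^{-uw} (1 - u/x)^(N+1)`. As `x
→ ∞`, `norm_rieszMean_add_le` yields `|f(σ₀ + w)| ≤ C (|w| / Re w)^(N+1)`, which is bounded on the
sector. -/

/-! ### Raising the order of Riesz means -/

/-- The factor `v^m` clears the denominator of `(1 - a/v)^m`; the substitution `v = a + (1 - a) u`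
then leaves a Beta integral. -/
theorem integral_riesz_kernel {m p a : ℝ} (ha : 0 ≤ a) (ha1 : a < 1) :
    ∫ v in (0 : ℝ)..1, v ^ m * (1 - v) ^ p * (if a < v then (1 - a / v) ^ m else 0) =
      (1 - a) ^ (m + p + 1) * ∫ u in (0 : ℝ)..1, u ^ m * (1 - u) ^ p := by
  have h1 : 0 < 1 - a := by linarith
  have e1 : ∫ v in (0 : ℝ)..1, v ^ m * (1 - v) ^ p * (if a < v then (1 - a / v) ^ m else 0) =
      ∫ v in a..1, (v - a) ^ m * (1 - v) ^ p := by
    rw [intervalIntegral.integral_of_le zero_le_one, intervalIntegral.integral_of_le ha1.le,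
      ← MeasureTheory.integral_indicator measurableSet_Ioc,
      ← MeasureTheory.integral_indicator measurableSet_Ioc]
    congr 1
    ext v
    by_cases hv : a < v ∧ v ≤ 1
    · have hv0 : 0 < v := ha.trans_lt hv.1
      rw [Set.indicator_of_mem (show v ∈ Set.Ioc 0 1 from ⟨hv0, hv.2⟩),
        Set.indicator_of_mem (show v ∈ Set.Ioc a 1 from hv), if_pos hv.1, mul_right_comm,
        ← Real.mul_rpow hv0.le (by rw [sub_nonneg, div_le_one hv0]; exact hv.1.le)]
      congr 2
      field_simp
    · rw [Set.indicator_of_notMem (show v ∉ Set.Ioc a 1 from hv)]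
      by_cases hv' : v ∈ Set.Ioc (0 : ℝ) 1
      · rw [Set.indicator_of_mem hv', if_neg fun h => hv ⟨h, hv'.2⟩, mul_zero]
      · rw [Set.indicator_of_notMem hv']
  have e2 := intervalIntegral.integral_comp_mul_add (a := 0) (b := 1)
    (fun v : ℝ => (v - a) ^ m * (1 - v) ^ p) h1.ne' a
  simp only [mul_zero, zero_add, mul_one, sub_add_cancel] at e2
  rw [e1, eq_comm, ← intervalIntegral.integral_const_mul]
  have e3 : ∀ u ∈ Set.uIcc (0 : ℝ) 1, (1 - a) ^ (m + p + 1) * (u ^ m * (1 - u) ^ p) =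
      (1 - a) * (((1 - a) * u + a - a) ^ m * (1 - ((1 - a) * u + a)) ^ p) := by
    intro u hu
    rw [Set.uIcc_of_le zero_le_one] at hu
    rw [show 1 - ((1 - a) * u + a) = (1 - a) * (1 - u) by ring, add_sub_cancel_right,
      Real.mul_rpow h1.le hu.1, Real.mul_rpow h1.le (by linarith [hu.2]), Real.rpow_add h1,
      Real.rpow_add h1, Real.rpow_one]
    ring
  rw [intervalIntegral.integral_congr e3, intervalIntegral.integral_const_mul, e2, smul_eq_mul,
    mul_inv_cancel_left₀ h1.ne']

theorem Frequency.mem_below {lam : Frequency} {x : ℝ} {n : ℕ} : n ∈ lam.below x ↔ lam n < x := by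
  simp [Frequency.below]

/-- A summation range independent of `y` allows the sum to be exchanged with an integral over `y`.
-/
theorem rieszMean_eq_sum_of_le (lam : Frequency) (m : ℝ) (a : ℕ → ℂ) (s : ℂ) {x y : ℝ}
    (hxy : y ≤ x) :
    rieszMean lam m a y s = ∑ n ∈ lam.below x, a n * Complex.exp (-(lam n : ℂ) * s) *
      ((if lam n < y then (1 - lam n / y) ^ m else 0 : ℝ) : ℂ) := by
  unfold rieszMean
  have hsub : lam.below y ⊆ lam.below x := fun n hn =>
    Frequency.mem_below.2 ((Frequency.mem_below.1 hn).trans_le hxy)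
  rw [← Finset.sum_subset hsub]
  · exact Finset.sum_congr rfl fun n hn => by rw [if_pos (Frequency.mem_below.1 hn)]
  · intro n _ hn
    rw [if_neg fun h => hn (Frequency.mem_below.2 h)]
    simp

theorem rieszMean_mul_eq (lam : Frequency) (m : ℝ) (a : ℕ → ℂ) (s : ℂ) {x v : ℝ} (hx : 0 < x)
    (hv1 : v ≤ 1) :
    rieszMean lam m a (x * v) s = ∑ n ∈ lam.below x, a n * Complex.exp (-(lam n : ℂ) * s) *
      ((if lam n / x < v then (1 - lam n / x / v) ^ m else 0 : ℝ) : ℂ) := by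
  rw [rieszMean_eq_sum_of_le lam m a s (mul_le_of_le_one_right hx.le hv1)]
  simp only [div_lt_iff₀' hx, div_div]

theorem riesz_factor_mem_Icc {m a v : ℝ} (hm : 0 ≤ m) (ha : 0 ≤ a) (hv : 0 < v) :
    (if a < v then (1 - a / v) ^ m else 0) ∈ Set.Icc (0 : ℝ) 1 := by
  split_ifs with h
  · have h0 : 0 ≤ 1 - a / v := by rw [sub_nonneg, div_le_one hv]; exact h.le
    exact ⟨Real.rpow_nonneg h0 _, Real.rpow_le_one h0 (by linarith [div_nonneg ha hv.le]) hm⟩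
  · simp

theorem measurable_riesz_kernel (m p a : ℝ) :
    Measurable fun v : ℝ => v ^ m * (1 - v) ^ p * (if a < v then (1 - a / v) ^ m else 0) := by
  refine Measurable.mul (by fun_prop) (Measurable.ite measurableSet_Ioi ?_ measurable_const)
  fun_prop

theorem norm_rpow_mul_rpow_le_one {m p v : ℝ} (hm : 0 ≤ m) (hp : 0 ≤ p) (hv : v ∈ Set.Ioc (0:ℝ) 1) :
    ‖v ^ m * (1 - v) ^ p‖ ≤ 1 := by
  have h1 : 0 ≤ 1 - v := by linarith [hv.2]
  rw [Real.norm_of_nonneg (mul_nonneg (Real.rpow_nonneg hv.1.le _) (Real.rpow_nonneg h1 _))]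
  exact mul_le_one₀ (Real.rpow_le_one hv.1.le hv.2 hm) (Real.rpow_nonneg h1 _)
    (Real.rpow_le_one h1 (by linarith [hv.1]) hp)

theorem intervalIntegrable_riesz_kernel {m p a : ℝ} (hm : 0 ≤ m) (hp : 0 ≤ p) (ha : 0 ≤ a) :
    IntervalIntegrable
      (fun v : ℝ => v ^ m * (1 - v) ^ p * (if a < v then (1 - a / v) ^ m else 0))
      MeasureTheory.volume 0 1 := by
  refine (intervalIntegrable_const (c := (1 : ℝ))).mono_fun'
    (measurable_riesz_kernel m p a).aestronglyMeasurable ?_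
  rw [Set.uIoc_of_le zero_le_one]
  refine (MeasureTheory.ae_restrict_iff' measurableSet_Ioc).2 (MeasureTheory.ae_of_all _ fun v hv => ?_)
  have h := riesz_factor_mem_Icc hm ha hv.1
  beta_reduce
  rw [norm_mul]
  refine mul_le_one₀ (norm_rpow_mul_rpow_le_one hm hp hv) (norm_nonneg _) ?_
  rw [Real.norm_of_nonneg h.1]
  exact h.2

/-- Riesz means of a higher order are weighted averages of Riesz means of a lower order. -/
theorem integral_rieszMean (lam : Frequency) {m p : ℝ} (hm : 0 ≤ m) (hp : 0 ≤ p) (a : ℕ → ℂ)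
    (s : ℂ) {x : ℝ} (hx : 0 < x) :
    ∫ v in (0 : ℝ)..1, ((v ^ m * (1 - v) ^ p : ℝ) : ℂ) * rieszMean lam m a (x * v) s =
      rieszMean lam (m + p + 1) a x s * ((∫ u in (0 : ℝ)..1, u ^ m * (1 - u) ^ p : ℝ) : ℂ) := by
  have e : ∀ v ∈ Set.uIoc (0 : ℝ) 1,
      ((v ^ m * (1 - v) ^ p : ℝ) : ℂ) * rieszMean lam m a (x * v) s =
      ∑ n ∈ lam.below x, a n * Complex.exp (-(lam n : ℂ) * s) *
        ((v ^ m * (1 - v) ^ p * (if lam n / x < v then (1 - lam n / x / v) ^ m else 0) : ℝ) : ℂ) := by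
    intro v hv
    rw [Set.uIoc_of_le zero_le_one] at hv
    rw [rieszMean_mul_eq lam m a s hx hv.2, Finset.mul_sum]
    refine Finset.sum_congr rfl fun n _ => ?_
    push_cast
    ring
  rw [intervalIntegral.integral_congr_ae (MeasureTheory.ae_of_all _ e), intervalIntegral.integral_finsetSum]
  · rw [rieszMean, Finset.sum_mul]
    refine Finset.sum_congr rfl fun n hn => ?_
    rw [intervalIntegral.integral_const_mul, intervalIntegral.integral_ofReal,
      integral_riesz_kernel (div_nonneg (lam.nonneg n) hx.le)
        ((div_lt_one hx).2 (Frequency.mem_below.1 hn))]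
    push_cast
    ring
  · intro n _
    have h := intervalIntegrable_riesz_kernel hm hp (div_nonneg (lam.nonneg n) hx.le)
    exact IntervalIntegrable.const_mul ⟨h.1.ofReal, h.2.ofReal⟩ _

theorem norm_rieszMean_le (lam : Frequency) {m : ℝ} (hm : 0 ≤ m) (a : ℕ → ℂ) (s : ℂ) {x X : ℝ}
    (hx : 0 < x) (hX : x ≤ X) :
    ‖rieszMean lam m a x s‖ ≤
      ∑ n ∈ lam.below X, ‖a n * Complex.exp (-(lam n : ℂ) * s)‖ := by
  rw [rieszMean_eq_sum_of_le lam m a s hX]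
  refine (norm_sum_le _ _).trans (Finset.sum_le_sum fun n _ => ?_)
  have h := riesz_factor_mem_Icc hm (lam.nonneg n) hx
  rw [norm_mul, Complex.norm_real, Real.norm_of_nonneg h.1]
  exact mul_le_of_le_one_right (norm_nonneg _) h.2

/-- Convergence bounds the means for large `x`; for the other `x` they are sums over one finite
index set with Riesz factors in `[0, 1]`. -/
theorem RieszSummableAt.exists_norm_le {lam : Frequency} {m : ℝ} (hm : 0 ≤ m) {a : ℕ → ℂ} {s : ℂ}
    (h : RieszSummableAt lam m a s) : ∃ C : ℝ, 0 ≤ C ∧ ∀ x : ℝ, 0 < x →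
      ‖rieszMean lam m a x s‖ ≤ C := by
  obtain ⟨L, hL⟩ := h
  obtain ⟨X, hX⟩ := (hL.norm.eventually_le_const (lt_add_one ‖L‖)).exists_forall_of_atTop
  refine ⟨max (‖L‖ + 1) (∑ n ∈ lam.below X, ‖a n * Complex.exp (-(lam n : ℂ) * s)‖),
    le_max_of_le_left (by positivity), fun x hx => ?_⟩
  rcases le_total X x with h | h
  · exact (hX x h).trans (le_max_left _ _)
  · exact (norm_rieszMean_le lam hm a s hx h).trans (le_max_right _ _)

/-- Riesz summability of some order implies Riesz summability of larger orders,
with the same sum. -/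
theorem tendsto_rieszMean_add_one {lam : Frequency} {m p : ℝ} (hm : 0 ≤ m) (hp : 0 ≤ p)
    {a : ℕ → ℂ} {s L : ℂ} (h : Tendsto (fun x => rieszMean lam m a x s) atTop (𝓝 L)) :
    Tendsto (fun x => rieszMean lam (m + p + 1) a x s) atTop (𝓝 L) := by
  obtain ⟨C, hC0, hC⟩ := RieszSummableAt.exists_norm_le hm ⟨L, h⟩
  set B : ℝ := ∫ u in (0 : ℝ)..1, u ^ m * (1 - u) ^ p with hB
  have hcont : Continuous fun u : ℝ => u ^ m * (1 - u) ^ p :=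
    (Real.continuous_rpow_const hm).mul
      ((Real.continuous_rpow_const hp).comp (continuous_const.sub continuous_id))
  have hB0 : 0 < B := by
    refine intervalIntegral.intervalIntegral_pos_of_pos_on (hcont.intervalIntegrable _ _) ?_ one_pos
    intro u hu
    exact mul_pos (Real.rpow_pos_of_pos hu.1 _) (Real.rpow_pos_of_pos (by linarith [hu.2]) _)
  -- Dominated convergence: `x * v → ∞` for each fixed `v > 0`, and `C` dominates.
  have key : Tendsto
      (fun x : ℝ => ∫ v in (0 : ℝ)..1, ((v ^ m * (1 - v) ^ p : ℝ) : ℂ) * rieszMean lam m a (x * v) s)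
      atTop (𝓝 (∫ v in (0 : ℝ)..1, ((v ^ m * (1 - v) ^ p : ℝ) : ℂ) * L)) := by
    refine intervalIntegral.tendsto_integral_filter_of_dominated_convergence (fun _ => C) ?_ ?_
      intervalIntegrable_const ?_
    · filter_upwards [eventually_gt_atTop 0] with x hx
      rw [Set.uIoc_of_le zero_le_one]
      refine MeasureTheory.AEStronglyMeasurable.mul
        (Complex.continuous_ofReal.comp hcont).aestronglyMeasurable ?_
      refine MeasureTheory.AEStronglyMeasurable.congr (f := fun v : ℝ =>
        ∑ n ∈ lam.below x, a n * Complex.exp (-(lam n : ℂ) * s) *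
          ((if lam n / x < v then (1 - lam n / x / v) ^ m else 0 : ℝ) : ℂ)) ?_ ?_
      · refine (Finset.measurable_fun_sum _ fun n _ => Measurable.const_mul
          (Complex.measurable_ofReal.comp
            (Measurable.ite measurableSet_Ioi ?_ measurable_const)) _).aestronglyMeasurable
        fun_prop
      · refine (MeasureTheory.ae_restrict_iff' measurableSet_Ioc).2 (MeasureTheory.ae_of_all _ fun v hv => ?_)
        exact (rieszMean_mul_eq lam m a s hx hv.2).symm
    · filter_upwards [eventually_gt_atTop 0] with x hx
      refine MeasureTheory.ae_of_all _ fun v hv => ?_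
      rw [Set.uIoc_of_le zero_le_one] at hv
      rw [norm_mul, Complex.norm_real]
      exact (mul_le_of_le_one_left (norm_nonneg _) (norm_rpow_mul_rpow_le_one hm hp hv)).trans
        (hC _ (mul_pos hx hv.1))
    · refine MeasureTheory.ae_of_all _ fun v hv => ?_
      rw [Set.uIoc_of_le zero_le_one] at hv
      exact (h.comp (tendsto_id.atTop_mul_const hv.1)).const_mul _
  rw [intervalIntegral.integral_mul_const, intervalIntegral.integral_ofReal] at key
  have hBC : (B : ℂ) ≠ 0 := by exact_mod_cast hB0.ne'
  have := key.const_mul ((B : ℂ)⁻¹)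
  rw [← hB, inv_mul_cancel_left₀ hBC] at this
  refine this.congr' ?_
  filter_upwards [eventually_gt_atTop 0] with x hx
  rw [integral_rieszMean lam hm hp a s hx, ← hB, mul_comm, mul_assoc, mul_inv_cancel₀ hBC, mul_one]

/-! ### Riesz means at a shifted point -/

/-- The `k`-th derivative of `u ↦ e^{-uw} (1 - c u)^M`. -/
noncomputable def expMulPowDeriv (w : ℂ) (c : ℝ) : ℕ → ℕ → ℝ → ℂ
  | 0, M, u => Complex.exp (-(u : ℂ) * w) * (1 - c * u) ^ M
  | k + 1, M, u => -(M * c) * expMulPowDeriv w c k (M - 1) u - w * expMulPowDeriv w c k M u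

/-- The truncated `M - 1` is harmless at `M = 0`, since its coefficient `M * c` vanishes. -/
theorem hasDerivAt_expMulPowDeriv (w : ℂ) (c : ℝ) (k M : ℕ) (u : ℝ) :
    HasDerivAt (expMulPowDeriv w c k M) (expMulPowDeriv w c (k + 1) M u) u := by
  induction k generalizing M with
  | zero =>
    have h0 : HasDerivAt (fun u : ℝ => (u : ℂ)) 1 u := Complex.ofRealCLM.hasDerivAt
    have h1 : HasDerivAt (fun u : ℝ => -(u : ℂ) * w) (-1 * w) u := h0.neg.mul_const w
    have h2 : HasDerivAt (fun u : ℝ => 1 - (c : ℂ) * u) (-(c * 1)) u :=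
      (h0.const_mul (c : ℂ)).const_sub 1
    refine (h1.cexp.mul (h2.fun_pow M)).congr_deriv ?_
    simp only [expMulPowDeriv]
    ring
  | succ k ih => exact ((ih (M - 1)).const_mul _).sub ((ih M).const_mul w)

theorem continuous_expMulPowDeriv (w : ℂ) (c : ℝ) (k M : ℕ) :
    Continuous (expMulPowDeriv w c k M) :=
  continuous_iff_continuousAt.2 fun u => (hasDerivAt_expMulPowDeriv w c k M u).continuousAt

theorem expMulPowDeriv_eq_zero (w : ℂ) {c x : ℝ} (hx : c * x = 1) {k M : ℕ} (h : k < M) :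
    expMulPowDeriv w c k M x = 0 := by
  induction k generalizing M with
  | zero =>
    have : (c : ℂ) * x = 1 := by exact_mod_cast hx
    simp [expMulPowDeriv, this, h.ne']
  | succ k ih => simp [expMulPowDeriv, ih (show k < M - 1 by omega), ih (show k < M by omega)]

/-- Each differentiation costs at most a factor `‖w‖ + M * c`. -/
theorem norm_expMulPowDeriv_le (w : ℂ) {c u : ℝ} (hc : 0 ≤ c) (hu : 0 ≤ u) (hcu : c * u ≤ 1)
    (k M : ℕ) :
    ‖expMulPowDeriv w c k M u‖ ≤ Real.exp (-(w.re * u)) * (‖w‖ + M * c) ^ k := by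
  induction k generalizing M with
  | zero =>
    have h1 : ‖(1 - c * u : ℂ)‖ ≤ 1 := by
      rw [show (1 - c * u : ℂ) = ((1 - c * u : ℝ) : ℂ) by push_cast; ring, Complex.norm_real,
        Real.norm_of_nonneg (by linarith)]
      linarith [mul_nonneg hc hu]
    simp only [expMulPowDeriv, norm_mul, Complex.norm_exp, norm_pow, pow_zero, mul_one]
    rw [show (-(u : ℂ) * w).re = -(w.re * u) by simp [mul_comm]]
    exact mul_le_of_le_one_right (Real.exp_pos _).le (pow_le_one₀ (norm_nonneg _) h1)
  | succ k ih =>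
    have hM : ((M - 1 : ℕ) : ℝ) ≤ M := by exact_mod_cast Nat.sub_le M 1
    have h1 : ‖expMulPowDeriv w c k (M - 1) u‖ ≤
        Real.exp (-(w.re * u)) * (‖w‖ + M * c) ^ k := (ih (M - 1)).trans (by gcongr)
    have hMc : ‖(-(M * c) : ℂ)‖ = M * c := by
      rw [norm_neg, norm_mul, Complex.norm_natCast, Complex.norm_real, Real.norm_of_nonneg hc]
    calc ‖expMulPowDeriv w c (k + 1) M u‖
        ≤ M * c * ‖expMulPowDeriv w c k (M - 1) u‖ + ‖w‖ * ‖expMulPowDeriv w c k M u‖ := by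
          rw [← hMc, ← norm_mul, ← norm_mul]
          exact norm_sub_le _ _
      _ ≤ M * c * (Real.exp (-(w.re * u)) * (‖w‖ + M * c) ^ k) +
          ‖w‖ * (Real.exp (-(w.re * u)) * (‖w‖ + M * c) ^ k) := by
          gcongr
          exact ih M
      _ = _ := by ring

/-- Repeated integration by parts. The zero of order `M` at `x` kills the boundary terms there;
powers of `u - y` kill those at `y`, until the last step. -/
theorem integral_expMulPowDeriv (w : ℂ) {c x : ℝ} (hx : c * x = 1) {k M : ℕ} (h : k < M) (y : ℝ) :
    ∫ u in y..x, ((u : ℂ) - y) ^ k * expMulPowDeriv w c (k + 1) M u =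
      (-1) ^ (k + 1) * k.factorial * expMulPowDeriv w c 0 M y := by
  induction k with
  | zero =>
    simp only [pow_zero, one_mul]
    rw [intervalIntegral.integral_eq_sub_of_hasDerivAt
      (fun u _ => hasDerivAt_expMulPowDeriv w c 0 M u)
      ((continuous_expMulPowDeriv w c _ M).intervalIntegrable _ _), expMulPowDeriv_eq_zero w hx h]
    simp
  | succ k ih =>
    have hd : ∀ u ∈ Set.uIcc y x, HasDerivAt (fun u : ℝ => ((u : ℂ) - y) ^ (k + 1))
        ((k + 1) * ((u : ℂ) - y) ^ k) u := by
      intro u _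
      have h0 : HasDerivAt (fun u : ℝ => (u : ℂ) - y) 1 u :=
        Complex.ofRealCLM.hasDerivAt.sub_const _
      refine (h0.fun_pow (k + 1)).congr_deriv ?_
      simp
    rw [intervalIntegral.integral_mul_deriv_eq_deriv_mul hd
      (fun u _ => hasDerivAt_expMulPowDeriv w c (k + 1) M u)
      (Continuous.intervalIntegrable (by fun_prop) _ _)
      ((continuous_expMulPowDeriv w c _ M).intervalIntegrable _ _), expMulPowDeriv_eq_zero w hx h]
    simp only [mul_assoc, intervalIntegral.integral_const_mul, ih (by omega)]
    rw [Nat.factorial_succ]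
    push_cast
    simp
    ring

/-- Riesz means at a shifted point as an integral of Riesz means of lower order. -/
theorem integral_expMulPowDeriv_mul_rieszMean (lam : Frequency) (a : ℕ → ℂ) (s w : ℂ) {x : ℝ}
    (hx : 0 < x) {N M : ℕ} (hNM : N < M) :
    ∫ u in (0 : ℝ)..x, (u : ℂ) ^ N * rieszMean lam N a u s * expMulPowDeriv w x⁻¹ (N + 1) M u =
      (-1) ^ (N + 1) * N.factorial * rieszMean lam M a x (s + w) := by
  have hgi (n : ℕ) : IntervalIntegrable
      (fun u : ℝ => ((u : ℂ) - lam n) ^ N * expMulPowDeriv w x⁻¹ (N + 1) M u)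
      MeasureTheory.volume 0 x := by
    have := continuous_expMulPowDeriv w x⁻¹ (N + 1) M
    exact Continuous.intervalIntegrable (by fun_prop) _ _
  -- The factor `u^N` turns `(1 - λₙ/u)^N` into the polynomial `(u - λₙ)^N`.
  have e : ∀ u ∈ Set.uIoc (0 : ℝ) x,
      (u : ℂ) ^ N * rieszMean lam N a u s * expMulPowDeriv w x⁻¹ (N + 1) M u =
      ∑ n ∈ lam.below x, a n * Complex.exp (-(lam n : ℂ) * s) *
        (Set.Ioi (lam n)).indicator
          (fun u : ℝ => ((u : ℂ) - lam n) ^ N * expMulPowDeriv w x⁻¹ (N + 1) M u) u := by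
    intro u hu
    rw [Set.uIoc_of_le hx.le] at hu
    rw [rieszMean_eq_sum_of_le lam N a s hu.2, Finset.mul_sum, Finset.sum_mul]
    refine Finset.sum_congr rfl fun n _ => ?_
    have hu0 : (u : ℂ) ≠ 0 := by exact_mod_cast hu.1.ne'
    by_cases h : lam n < u
    · rw [if_pos h, Set.indicator_of_mem (Set.mem_Ioi.2 h), Real.rpow_natCast]
      have : ((u : ℂ) - lam n) ^ N = (u : ℂ) ^ N * (1 - lam n / u) ^ N := by
        rw [← mul_pow]
        congr 1
        field_simp
      rw [this]
      push_cast
      ring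
    · rw [if_neg h, Set.indicator_of_notMem (by simpa using h)]
      simp
  rw [intervalIntegral.integral_congr_ae (MeasureTheory.ae_of_all _ e),
    intervalIntegral.integral_finsetSum]
  · rw [rieszMean, Finset.mul_sum]
    refine Finset.sum_congr rfl fun n hn => ?_
    have hn' := Frequency.mem_below.1 hn
    have : ∫ u in (0 : ℝ)..x, (Set.Ioi (lam n)).indicator
        (fun u : ℝ => ((u : ℂ) - lam n) ^ N * expMulPowDeriv w x⁻¹ (N + 1) M u) u =
        ∫ u in (lam n)..x, ((u : ℂ) - lam n) ^ N * expMulPowDeriv w x⁻¹ (N + 1) M u := by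
      rw [intervalIntegral.integral_of_le hx.le, intervalIntegral.integral_of_le hn'.le,
        MeasureTheory.setIntegral_indicator measurableSet_Ioi, Set.Ioc_inter_Ioi,
        max_eq_right (lam.nonneg n)]
    rw [intervalIntegral.integral_const_mul, this,
      integral_expMulPowDeriv w (inv_mul_cancel₀ hx.ne') hNM, Real.rpow_natCast]
    simp only [expMulPowDeriv]
    rw [mul_add (-(lam n : ℂ)) s w, Complex.exp_add]
    push_cast
    ring
  · intro n _
    refine IntervalIntegrable.const_mul ?_ _
    rw [intervalIntegrable_iff] at *
    exact (intervalIntegrable_iff.1 (hgi n)).indicator measurableSet_Ioi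

theorem integrableOn_exp_mul_pow {r : ℝ} (hr : 0 < r) (N : ℕ) :
    MeasureTheory.IntegrableOn (fun u : ℝ => Real.exp (-(r * u)) * u ^ N) (Set.Ioi 0) ∧
      ∫ u in Set.Ioi (0 : ℝ), Real.exp (-(r * u)) * u ^ N = N.factorial / r ^ (N + 1) := by
  have h := Real.integral_rpow_mul_exp_neg_mul_Ioi (a := (N : ℝ) + 1) (by positivity) hr
  rw [Real.Gamma_nat_eq_factorial] at h
  simp only [add_sub_cancel_right, Real.rpow_natCast] at h
  have e : ∫ u in Set.Ioi (0 : ℝ), Real.exp (-(r * u)) * u ^ N = N.factorial / r ^ (N + 1) := by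
    simp only [mul_comm (Real.exp _)]
    rw [h, show ((N : ℝ) + 1) = ((N + 1 : ℕ) : ℝ) by push_cast; rfl, Real.rpow_natCast,
      one_div, inv_pow, mul_comm, div_eq_mul_inv]
  -- A non-integrable function has integral `0` by convention, so a nonzero value forces
  -- integrability.
  refine ⟨MeasureTheory.Integrable.of_integral_ne_zero ?_, e⟩
  rw [e]
  positivity

theorem norm_rieszMean_add_le (lam : Frequency) (a : ℕ → ℂ) (s : ℂ) {w : ℂ} (hw : 0 < w.re)
    {x : ℝ} (hx : 0 < x) {N M : ℕ} (hNM : N < M) {C : ℝ}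
    (hC : ∀ u : ℝ, 0 < u → ‖rieszMean lam N a u s‖ ≤ C) :
    ‖rieszMean lam M a x (s + w)‖ ≤ C * ((‖w‖ + M * x⁻¹) / w.re) ^ (N + 1) := by
  have hC0 : 0 ≤ C := (norm_nonneg _).trans (hC 1 one_pos)
  obtain ⟨hi, he⟩ := integrableOn_exp_mul_pow hw N
  set A : ℝ := C * (‖w‖ + M * x⁻¹) ^ (N + 1) with hA
  have hA0 : 0 ≤ A := by positivity
  have h1 : ‖∫ u in (0 : ℝ)..x,
      (u : ℂ) ^ N * rieszMean lam N a u s * expMulPowDeriv w x⁻¹ (N + 1) M u‖ ≤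
      ∫ u in (0 : ℝ)..x, A * (Real.exp (-(w.re * u)) * u ^ N) := by
    refine intervalIntegral.norm_integral_le_of_norm_le hx.le
      (MeasureTheory.ae_of_all _ fun u hu => ?_)
      (Continuous.intervalIntegrable (by fun_prop) _ _)
    rw [norm_mul, norm_mul, norm_pow, Complex.norm_real, Real.norm_of_nonneg hu.1.le]
    have hxu : x⁻¹ * u ≤ 1 := by rw [inv_mul_le_iff₀ hx, mul_one]; exact hu.2
    calc u ^ N * ‖rieszMean lam N a u s‖ * ‖expMulPowDeriv w x⁻¹ (N + 1) M u‖
        ≤ u ^ N * C * (Real.exp (-(w.re * u)) * (‖w‖ + M * x⁻¹) ^ (N + 1)) := by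
          have := hu.1.le
          gcongr
          · exact hC u hu.1
          · exact norm_expMulPowDeriv_le w (inv_nonneg.2 hx.le) hu.1.le hxu _ _
      _ = _ := by rw [hA]; ring
  have h2 : ∫ u in (0 : ℝ)..x, A * (Real.exp (-(w.re * u)) * u ^ N) ≤
      A * (N.factorial / w.re ^ (N + 1)) := by
    rw [intervalIntegral.integral_const_mul, ← he, intervalIntegral.integral_of_le hx.le]
    refine mul_le_mul_of_nonneg_left (MeasureTheory.setIntegral_mono_set hi ?_
      (LE.le.eventuallyLE Set.Ioc_subset_Ioi_self)) hA0
    refine (MeasureTheory.ae_restrict_iff' measurableSet_Ioi).2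
      (MeasureTheory.ae_of_all _ fun u hu => ?_)
    exact mul_nonneg (Real.exp_pos _).le (pow_nonneg (le_of_lt hu) _)
  have h3 := h1.trans h2
  rw [integral_expMulPowDeriv_mul_rieszMean lam a s w hx hNM, norm_mul, norm_mul, norm_pow,
    norm_neg, norm_one, one_pow, one_mul, Complex.norm_natCast] at h3
  have hf : (0 : ℝ) < N.factorial := by exact_mod_cast N.factorial_pos
  refine le_of_mul_le_mul_left (h3.trans_eq ?_) hf
  rw [hA, div_pow]
  ring

/-! ### Boundedness in a sector -/

theorem rieszAbscissa_le {lam : Frequency} {m : ℝ} {a : ℕ → ℂ} {σ : ℝ}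
    (h : RieszSummableAt lam m a σ) : rieszAbscissa lam m a ≤ σ :=
  sInf_le ⟨σ, h, rfl⟩

theorem exists_rieszSummableAt_of_rieszAbscissa_lt {lam : Frequency} {m : ℝ} {a : ℕ → ℂ}
    {c : EReal} (h : rieszAbscissa lam m a < c) :
    ∃ σ : ℝ, RieszSummableAt lam m a σ ∧ (σ : EReal) < c := by
  obtain ⟨_, ⟨σ, hσ, rfl⟩, h⟩ := sInf_lt_iff.1 h
  exact ⟨σ, hσ, h⟩

/-- A function with a Riesz germ is bounded on the part of a sector with large real part. -/
theorem HasRieszGerm.exists_norm_le {lam : Frequency} {f : ℂ → ℂ} (h : HasRieszGerm lam f) :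
    ∃ σ₁ : ℝ, 0 < σ₁ ∧ ∃ C : ℝ, 0 < C ∧ ∀ s : ℂ, σ₁ ≤ s.re → |s.im| ≤ s.re → ‖f s‖ ≤ C := by
  obtain ⟨a, m, hm, hlt, hf⟩ := h
  obtain ⟨σ₀, hσ₀, -⟩ := exists_rieszSummableAt_of_rieszAbscissa_lt hlt
  -- Raising the order goes from `m` to `m + p + 1` with `p ≥ 0`, hence by at least one.
  obtain ⟨N, hN⟩ := exists_nat_ge (m + 1)
  have hord {M : ℕ} (hM : N ≤ M) {s L : ℂ}
      (h : Tendsto (fun x => rieszMean lam m a x s) atTop (𝓝 L)) :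
      Tendsto (fun x => rieszMean lam M a x s) atTop (𝓝 L) := by
    have hM' : (N : ℝ) ≤ M := by exact_mod_cast hM
    have := tendsto_rieszMean_add_one hm (p := M - m - 1) (by linarith) h
    rwa [show m + ((M : ℝ) - m - 1) + 1 = M by ring] at this
  obtain ⟨L, hL⟩ := hσ₀
  obtain ⟨C, hC0, hC⟩ := RieszSummableAt.exists_norm_le N.cast_nonneg ⟨L, hord le_rfl hL⟩
  -- This abscissa gives `Re w ≥ |σ₀| + 1`, so `|w| ≤ Re w + Re s = 2 Re w + σ₀ ≤ 5 Re w`. The final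
  -- `+ 1` makes the bound positive even if `C = 0`.
  refine ⟨2 * |σ₀| + 1, by positivity, C * 5 ^ (N + 1) + 1, by positivity, fun s hs him => ?_⟩
  have hσ := abs_nonneg σ₀
  have hσ' := le_abs_self σ₀
  have hσ'' := neg_abs_le σ₀
  set w : ℂ := s - σ₀ with hw
  have hwre : w.re = s.re - σ₀ := by simp [hw]
  have hwim : w.im = s.im := by simp [hw]
  have hw0 : 0 < w.re := by rw [hwre]; linarith
  have hlim : Tendsto (fun x => rieszMean lam ((N + 1 : ℕ) : ℝ) a x s) atTop (𝓝 (f s)) :=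
    hord N.le_succ (hf s (show 0 < s.re by linarith) ((rieszAbscissa_le ⟨L, hL⟩).trans_lt
      (EReal.coe_lt_coe_iff.2 (by linarith))))
  have hlim' : Tendsto (fun x : ℝ => C * ((‖w‖ + ((N + 1 : ℕ) : ℝ) * x⁻¹) / w.re) ^ (N + 1)) atTop
      (𝓝 (C * ((‖w‖ + ((N + 1 : ℕ) : ℝ) * 0) / w.re) ^ (N + 1))) :=
    (((tendsto_inv_atTop_zero.const_mul _).const_add _).div_const _ |>.pow _).const_mul _
  have hle := le_of_tendsto_of_tendsto hlim.norm hlim' (by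
    filter_upwards [eventually_gt_atTop 0] with x hx
    have := norm_rieszMean_add_le lam a σ₀ hw0 hx N.lt_succ_self hC
    rwa [hw, add_sub_cancel] at this)
  rw [mul_zero, add_zero] at hle
  have hratio : ‖w‖ / w.re ≤ 5 := by
    rw [div_le_iff₀ hw0]
    refine (Complex.norm_le_abs_re_add_abs_im w).trans ?_
    rw [abs_of_pos hw0, hwim, hwre]
    linarith
  calc ‖f s‖ ≤ C * (‖w‖ / w.re) ^ (N + 1) := hle
    _ ≤ C * 5 ^ (N + 1) := by gcongr
    _ ≤ _ := by linarith

/-! ### Translation of germs -/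

theorem rieszMean_shift (lam : Frequency) (m : ℝ) (a : ℕ → ℂ) (x : ℝ) (c s : ℂ) :
    rieszMean lam m (fun n => a n * Complex.exp (-(lam n : ℂ) * c)) x s =
      rieszMean lam m a x (c + s) := by
  refine Finset.sum_congr rfl fun n _ => ?_
  rw [mul_add, Complex.exp_add, mul_assoc (a n)]

theorem rieszSummableAt_shift {lam : Frequency} {m : ℝ} {a : ℕ → ℂ} {c s : ℂ} :
    RieszSummableAt lam m (fun n => a n * Complex.exp (-(lam n : ℂ) * c)) s ↔
      RieszSummableAt lam m a (c + s) := by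
  simp only [RieszSummableAt, rieszMean_shift]

/-- Translating a function to the right translates its Riesz germ. -/
theorem HasRieszGerm.shift {lam : Frequency} {f : ℂ → ℂ} (h : HasRieszGerm lam f) {μ : ℝ}
    (hμ : 0 ≤ μ) : HasRieszGerm lam fun s => f (μ + s) := by
  obtain ⟨a, m, hm, hlt, hf⟩ := h
  refine ⟨fun n => a n * Complex.exp (-(lam n : ℂ) * μ), m, hm, ?_, fun s hs hlts => ?_⟩
  · obtain ⟨σ, hσ, -⟩ := exists_rieszSummableAt_of_rieszAbscissa_lt hlt
    refine (rieszAbscissa_le (σ := σ - μ) (rieszSummableAt_shift.2 ?_)).trans_lt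
      (EReal.coe_lt_top _)
    rwa [Complex.ofReal_sub, add_sub_cancel]
  · obtain ⟨σ, hσ, hσs⟩ := exists_rieszSummableAt_of_rieszAbscissa_lt hlts
    rw [rieszSummableAt_shift, ← Complex.ofReal_add] at hσ
    simp only [rieszMean_shift]
    have hre : ((μ : ℂ) + s).re = μ + s.re := by simp
    refine hf _ ?_ ((rieszAbscissa_le hσ).trans_lt ?_)
    · exact (show 0 < ((μ : ℂ) + s).re from hre ▸ add_pos_of_nonneg_of_pos hμ hs)
    · rw [hre]
      exact EReal.coe_lt_coe_iff.2 (by linarith [EReal.coe_lt_coe_iff.1 hσs])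

/-! ### Comparison of the two growth conditions -/

theorem uniformOrderBound_of_mem_HInfty {lam : Frequency} {f : ℂ → ℂ} {l : ℝ} (hl : 0 ≤ l)
    (h : f ∈ HInfty lam l) : UniformOrderBound f 0 l := by
  obtain ⟨-, hgerm, B, hB⟩ := h
  obtain ⟨σ₁, hσ₁, C, hC, hfC⟩ := hgerm.exists_norm_le
  refine ⟨max C (|B| * 3 ^ l), lt_max_of_lt_left hC, max σ₁ 1, lt_max_of_lt_left hσ₁,
    fun σ hσ t ht => ?_⟩
  obtain ⟨ht1, ht2⟩ := max_lt_iff.1 ht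
  set s : ℂ := σ + t * Complex.I with hs
  have hre : s.re = σ := by simp [hs]
  have him : s.im = t := by simp [hs]
  have htl : 1 ≤ |t| ^ l := Real.one_le_rpow ht2.le hl
  rcases le_total |t| σ with h | h
  · calc ‖f s‖ ≤ C := hfC s (by rw [hre]; linarith) (by rw [hre, him]; exact h)
      _ ≤ C * |t| ^ l := le_mul_of_one_le_right hC.le htl
      _ ≤ _ := by gcongr; exact le_max_left _ _
  -- Here `1`, `σ` and `|t|` are all at most `|t|`.
  · have hn : 1 + ‖s‖ ≤ 3 * |t| := by
      have := Complex.norm_le_abs_re_add_abs_im s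
      rw [hre, him, abs_of_pos hσ] at this
      linarith
    have h1 := hB ⟨s, show 0 < s.re by rwa [hre], rfl⟩
    have hpos : 0 < (1 + ‖s‖) ^ l := by positivity
    rw [div_le_iff₀ hpos] at h1
    calc ‖f s‖ ≤ |B| * (1 + ‖s‖) ^ l := h1.trans (by gcongr; exact le_abs_self B)
      _ ≤ |B| * (3 * |t|) ^ l := by gcongr
      _ = |B| * 3 ^ l * |t| ^ l := by
        rw [Real.mul_rpow (by norm_num) (abs_nonneg t), mul_assoc]
      _ ≤ _ := by gcongr; exact le_max_right _ _

theorem shift_mem_HInfty {lam : Frequency} {f : ℂ → ℂ} (hf : DifferentiableOn ℂ f rightHalfPlane)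
    (hgerm : HasRieszGerm lam f) {l' l : ℝ} (hl' : 0 ≤ l') (hl : l' ≤ l)
    (h : UniformOrderBound f 0 l') {μ : ℝ} (hμ : 0 < μ) :
    (fun s : ℂ => f (μ + s)) ∈ HInfty lam l := by
  refine ⟨?_, hgerm.shift hμ.le, ?_⟩
  · refine hf.comp (by fun_prop) fun s (hs : 0 < s.re) => ?_
    simpa [rightHalfPlane] using add_pos hμ hs
  obtain ⟨C₂, hC₂, t₀, -, hfC₂⟩ := h
  obtain ⟨σ₁, -, C₁, hC₁, hfC₁⟩ := hgerm.exists_norm_le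
  -- The rectangle left over by the order bound and the sector bound; `μ > 0` keeps it off the
  -- imaginary axis.
  have hK : IsCompact (Set.Icc μ (max σ₁ t₀) ×ℂ Set.Icc (-t₀) t₀) :=
    isCompact_Icc.reProdIm isCompact_Icc
  obtain ⟨C₃, hC₃⟩ := hK.exists_bound_of_continuousOn
    (hf.continuousOn.mono fun z hz => hμ.trans_le hz.1.1)
  refine ⟨max C₁ (max C₂ C₃), ?_⟩
  rintro _ ⟨s, hs, rfl⟩
  have hs : 0 < s.re := hs
  have hbase : 1 ≤ 1 + ‖s‖ := by linarith [norm_nonneg s]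
  have hone : 1 ≤ (1 + ‖s‖) ^ l := Real.one_le_rpow hbase (hl'.trans hl)
  have hmax : 0 ≤ max C₁ (max C₂ C₃) := hC₁.le.trans (le_max_left _ _)
  beta_reduce
  rw [div_le_iff₀ (by positivity)]
  set z : ℂ := μ + s with hz
  have hre : z.re = μ + s.re := by simp [hz]
  have him : z.im = s.im := by simp [hz]
  rcases lt_or_ge t₀ |s.im| with ht | ht
  · have h1 := hfC₂ z.re (by rw [hre]; exact add_pos hμ hs) z.im (by rwa [him])
    rw [Complex.re_add_im, him] at h1
    calc ‖f z‖ ≤ C₂ * |s.im| ^ l' := h1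
      _ ≤ C₂ * (1 + ‖s‖) ^ l' := by
        gcongr
        linarith [Complex.abs_im_le_norm s]
      _ ≤ C₂ * (1 + ‖s‖) ^ l := by gcongr
      _ ≤ _ := by gcongr; exact (le_max_left _ _).trans (le_max_right _ _)
  · refine le_trans ?_ (le_mul_of_one_le_right hmax hone)
    rcases le_total (max σ₁ t₀) z.re with h | h
    · obtain ⟨h1, h2⟩ := max_le_iff.1 h
      -- `Re z ≥ t₀ ≥ |Im z|` puts `z` in the sector.
      exact (hfC₁ z h1 (him ▸ ht.trans h2)).trans (le_max_left _ _)
    · refine (hC₃ z ⟨⟨by linarith, h⟩, ?_⟩).trans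
        ((le_max_right _ _).trans (le_max_right _ _))
      exact abs_le.1 (him ▸ ht)

theorem mainTheorem3 (lam : Frequency) (f : ℂ → ℂ)
    (hf : DifferentiableOn ℂ f rightHalfPlane) (hgerm : HasRieszGerm lam f) :
    (∀ l : ℝ, 0 ≤ l → f ∈ HInfty lam l →
      HasFiniteUniformOrder f 0 ∧ uniformOrder f 0 ≤ ENNReal.ofReal l) ∧
    (HasFiniteUniformOrder f 0 →
      ∀ μ : ℝ, 0 < μ → ∀ l : ℝ, uniformOrder f 0 < ENNReal.ofReal l →
        (fun s : ℂ => f ((μ : ℂ) + s)) ∈ HInfty lam l) := by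
  refine ⟨fun l hl h => ?_, fun _ μ hμ l hl => ?_⟩
  · have hle : uniformOrder f 0 ≤ ENNReal.ofReal l := by
      refine sInf_le ⟨l.toNNReal, ?_, rfl⟩
      rw [Set.mem_ofPred_eq, Real.coe_toNNReal l hl]
      exact uniformOrderBound_of_mem_HInfty hl h
    exact ⟨hle.trans_lt ENNReal.ofReal_lt_top, hle⟩
  · obtain ⟨_, ⟨l', hl', rfl⟩, hlt⟩ := sInf_lt_iff.1 hl
    have hlt' : (l' : ℝ) < l := by
      have h : l' < l.toNNReal := ENNReal.coe_lt_coe.1 hlt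
      exact Real.lt_toNNReal_iff_coe_lt.1 h
    exact shift_mem_HInfty hf hgerm l'.coe_nonneg hlt'.le hl' hμ
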